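/- Let $u,v:\mathbb{C}\to\mathbb{R}$ be harmonic functions on the whole plane and let $f=u+iv:\mathbb{C}\to\mathbb{C}$. Assume that $u$ is a nonconstant harmonic polynomial (a real polynomial in $x=\operatorname{Re}z$ and $y=\operatorname{Im}z$). Suppose that there exist $a>0$ and $R>0$ such that $$f\big(\mathbb{C}\setminus D(0,R)\big)\subset\{s+it:\ s,t\in\mathbb{R},\ |s|\le a|t|\},$$ where $D(0,R)=\{z\in\mathbb{C}:|z|<R\}$. Then there exists $b\in\mathbb{R}$ with $|b|\le a$ such that $u=bv$ on $\mathbb{C}$. In particular, $v$ is also a polynomial in $x$ and $y$, and the range $f(\mathbb{C})$ is a line. -/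

import Mathlib

/-- The map `f = u + i v` from the plane to the plane associated with two real functions
`u`, `v` on the plane. -/
noncomputable def planeMap (u v : ℂ → ℝ) : ℂ → ℂ :=
  fun z => (u z : ℂ) + Complex.I * (v z : ℂ)

/-- `f = u + i v` is an entire harmonic map: `u` and `v` are harmonic on the whole plane. -/
def IsEntireHarmonicMap (u v : ℂ → ℝ) : Prop :=
  InnerProductSpace.HarmonicOnNhd u Set.univ ∧ InnerProductSpace.HarmonicOnNhd v Set.univ

/-- `u` is a real polynomial in the two real coordinates `x = re z`, `y = im z`. -/
def IsPlanePolynomial (u : ℂ → ℝ) : Prop :=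
  ∃ P : MvPolynomial (Fin 2) ℝ, ∀ z : ℂ, u z = MvPolynomial.eval ![z.re, z.im] P

/-- The double cone `{u + i v : |u| ≤ a |v|}` with vertex at the origin. -/
def doubleCone (a : ℝ) : Set ℂ :=
  {w : ℂ | |w.re| ≤ a * |w.im|}

/-- `S` is a (real, affine) line in the plane. -/
def IsPlaneLine (S : Set ℂ) : Prop :=
  ∃ L : AffineSubspace ℝ ℂ, (L : Set ℂ).Nonempty ∧ Module.finrank ℝ L.direction = 1 ∧
    S = (L : Set ℂ)

/-! Write `u = Re F` and `v = Re G` with `F`, `G` entire; since `u` has polynomial growth, `F` is a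
polynomial, of degree `n ≥ 1`. On a circle of radius `r ≥ R`, each zero of `v` is a zero of `u`, and
there `u` is a trigonometric polynomial of degree `n`. So `v` has at most `2n` zeros on the circle,
hence `2d` sign changes with `d ≤ n`, and the product `Q` of the factors `ζ - s` over them makes `κ
v Q ζ⁻ᵈ ≥ 0` for some unimodular `κ` (`exists_subset_prod_sub_eq_norm`).

Thus the L¹ norm of `vQ` is a single Fourier coefficient of `vQ`, which involves only the
coefficients of `v` of index at most `d`. If `|U| ≤ A|v|`, this norm bounds the coefficients of
`UQ`; as `|Q(0)| = 1`, each coefficient of `U` of index `m > d` is bounded by lower ones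
(`norm_circleCoeff_le`).

Let `r → ∞`. With `U = v` this gives `deg G ≤ n`. With `U = u`, having `d < n` on all large circles
would kill the leading coefficient of `F`. So `d = n` on some circle: there `u` and `v` are
trigonometric polynomials of degree at most `n` with `2n` common zeros, hence proportional, and
proportionality extends to the plane. -/

/-! ### Fourier coefficients of real parts of entire functions. -/

theorem intervalIntegral_conj (f : ℝ → ℂ) (a b : ℝ) :
    ∫ x in a..b, (starRingEnd ℂ) (f x) = (starRingEnd ℂ) (∫ x in a..b, f x) := by
  simp only [intervalIntegral, integral_conj, map_sub]

open Complex in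
/-- The unnormalised Fourier coefficient of index `k` of a real function on the unit circle. -/
noncomputable def circleCoeff (V : ℂ → ℝ) (k : ℤ) : ℂ :=
  ∫ θ in (0 : ℝ)..2 * Real.pi, (V (exp (θ * I)) : ℂ) * exp (θ * I) ^ (-k)

theorem circleCoeff_neg (V : ℂ → ℝ) (k : ℤ) :
    circleCoeff V (-k) = (starRingEnd ℂ) (circleCoeff V k) := by
  unfold circleCoeff
  rw [← intervalIntegral_conj]
  congr 1
  ext θ
  rw [map_mul, Complex.conj_ofReal, map_zpow₀, ← Complex.exp_conj]
  simp [Complex.exp_neg]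

theorem norm_circleCoeff_neg (V : ℂ → ℝ) (k : ℤ) :
    ‖circleCoeff V (-k)‖ = ‖circleCoeff V k‖ := by
  rw [circleCoeff_neg, RCLike.norm_conj]

/-- Cauchy's formula for the Taylor coefficients, as an integral over the angle. -/
theorem integral_entire_mul_zpow_neg {G : ℂ → ℂ} (hG : Differentiable ℂ G) (m : ℕ) :
    ∫ θ in (0 : ℝ)..2 * Real.pi,
      G (Complex.exp (θ * Complex.I)) * Complex.exp (θ * Complex.I) ^ (-(m : ℤ)) =
      2 * Real.pi * (iteratedDeriv m G 0 / m.factorial) := by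
  have h := DiffContOnCl.circleIntegral_one_div_sub_center_pow_smul (c := 0) (R := 1) one_pos m
    (hG.diffContOnCl)
  rw [circleIntegral] at h
  have h2 : ∀ θ : ℝ, deriv (circleMap 0 1) θ • ((1 / (circleMap 0 1 θ - 0) ^ (m + 1)) •
      G (circleMap 0 1 θ)) = Complex.I * (G (Complex.exp (θ * Complex.I)) *
        Complex.exp (θ * Complex.I) ^ (-(m : ℤ))) := by
    intro θ
    have : Complex.exp (θ * Complex.I) ≠ 0 := Complex.exp_ne_zero _
    simp only [deriv_circleMap, circleMap_zero, Complex.ofReal_one, one_mul, sub_zero, smul_eq_mul,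
      zpow_neg, zpow_natCast]
    field_simp
    ring
  simp_rw [h2] at h
  rw [intervalIntegral.integral_const_mul] at h
  apply mul_left_cancel₀ Complex.I_ne_zero
  rw [h, smul_eq_mul]
  ring

theorem integral_entire_mul_pow {G : ℂ → ℂ} (hG : Differentiable ℂ G) {m : ℕ} (hm : m ≠ 0) :
    ∫ θ in (0 : ℝ)..2 * Real.pi,
      G (Complex.exp (θ * Complex.I)) * Complex.exp (θ * Complex.I) ^ m = 0 := by
  have h := integral_entire_mul_zpow_neg (G := fun z => G z * z ^ m) (by fun_prop) 0
  simpa [hm] using h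

theorem continuous_exp_mul_I_zpow (k : ℤ) :
    Continuous fun θ : ℝ => Complex.exp (θ * Complex.I) ^ k := by
  apply Continuous.zpow₀ (by fun_prop)
  intro θ
  exact Or.inl (Complex.exp_ne_zero _)

/-- Split `Re G` as `(G + conj G) / 2`. Cauchy's formula evaluates the first half; the second has
only nonpositive frequencies, so it contributes only when `m = 0`. -/
theorem circleCoeff_re_entire {G : ℂ → ℂ} (hG : Differentiable ℂ G) (m : ℕ) :
    circleCoeff (fun z => (G z).re) m =
      Real.pi * (iteratedDeriv m G 0 / m.factorial +
        if m = 0 then (starRingEnd ℂ) (G 0) else 0) := by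
  have hc := hG.continuous
  have e : ∀ θ : ℝ, (((G (Complex.exp (θ * Complex.I))).re : ℝ) : ℂ) *
      Complex.exp (θ * Complex.I) ^ (-(m : ℤ)) =
      (1 / 2) * (G (Complex.exp (θ * Complex.I)) * Complex.exp (θ * Complex.I) ^ (-(m : ℤ))) +
      (1 / 2) * (starRingEnd ℂ) (G (Complex.exp (θ * Complex.I)) *
        Complex.exp (θ * Complex.I) ^ m) := by
    intro θ
    rw [Complex.re_eq_add_conj, map_mul, map_pow, ← Complex.exp_conj, zpow_neg, zpow_natCast,
      ← inv_pow, ← Complex.exp_neg]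
    simp
    ring
  have hz := continuous_exp_mul_I_zpow (-(m : ℤ))
  have i1 : Continuous fun θ : ℝ =>
      G (Complex.exp (θ * Complex.I)) * Complex.exp (θ * Complex.I) ^ (-(m : ℤ)) := by
    fun_prop
  have i2 : Continuous fun θ : ℝ => (starRingEnd ℂ)
      (G (Complex.exp (θ * Complex.I)) * Complex.exp (θ * Complex.I) ^ m) :=
    Complex.continuous_conj.comp (by fun_prop)
  unfold circleCoeff
  simp_rw [e]
  rw [intervalIntegral.integral_add ((i1.const_mul _).intervalIntegrable _ _)
    ((i2.const_mul _).intervalIntegrable _ _), intervalIntegral.integral_const_mul,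
    intervalIntegral.integral_const_mul, integral_entire_mul_zpow_neg hG, intervalIntegral_conj]
  split_ifs with h
  · subst h
    have := integral_entire_mul_zpow_neg hG 0
    simp only [Nat.cast_zero, neg_zero, zpow_zero, mul_one] at this
    simp only [pow_zero, mul_one, this]
    have h2 : (starRingEnd ℂ) 2 = 2 := map_ofNat _ 2
    simp [h2]
    ring
  · rw [integral_entire_mul_pow hG h]
    simp
    ring

/-! ### Taylor coefficients and Fourier coefficients on circles of radius `r`. -/

/-- The Taylor coefficients of an entire function at the origin. -/
noncomputable def taylorCoeff (F : ℂ → ℂ) (m : ℕ) : ℂ := iteratedDeriv m F 0 / m.factorial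

theorem taylorCoeff_comp_mul {F : ℂ → ℂ} (hF : Differentiable ℂ F) (r : ℂ) (m : ℕ) :
    taylorCoeff (fun z => F (r * z)) m = r ^ m * taylorCoeff F m := by
  unfold taylorCoeff
  rw [iteratedDeriv_comp_const_mul hF.contDiff]
  simp [mul_div_assoc]

/-- For positive index, the Fourier coefficients of `Re F` on a circle are multiples of the Taylor
coefficients of `F`. -/
theorem circleCoeff_re_of_pos {F : ℂ → ℂ} (hF : Differentiable ℂ F) (r : ℝ) {m : ℕ} (hm : m ≠ 0) :
    circleCoeff (fun z => (F (r * z)).re) m = Real.pi * (r ^ m * taylorCoeff F m) := by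
  rw [← taylorCoeff_comp_mul hF, circleCoeff_re_entire (G := fun z => F (r * z)) (by fun_prop) m,
    taylorCoeff]
  simp [hm]

/-- The factor 2 is needed only at `m = 0`, where both `F 0` and its conjugate contribute. -/
theorem norm_circleCoeff_re_le {F : ℂ → ℂ} (hF : Differentiable ℂ F) {r : ℝ} (hr : 0 ≤ r) (m : ℕ) :
    ‖circleCoeff (fun z => (F (r * z)).re) m‖ ≤ 2 * Real.pi * (r ^ m * ‖taylorCoeff F m‖) := by
  have hpi := Real.pi_pos
  rcases eq_or_ne m 0 with rfl | hm
  · rw [circleCoeff_re_entire (G := fun z => F (r * z)) (by fun_prop) 0]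
    simp only [norm_mul, Complex.norm_real, Real.norm_eq_abs, abs_of_pos hpi, taylorCoeff]
    simp only [if_true, iteratedDeriv_zero, Nat.factorial_zero, Nat.cast_one, div_one, mul_zero,
      pow_zero, one_mul]
    have : ‖F 0 + (starRingEnd ℂ) (F 0)‖ ≤ ‖F 0‖ + ‖F 0‖ :=
      (norm_add_le _ _).trans (by rw [RCLike.norm_conj])
    nlinarith
  · rw [circleCoeff_re_of_pos hF r hm]
    simp only [norm_mul, Complex.norm_real, Real.norm_eq_abs, abs_of_pos hpi, norm_pow,
      abs_of_nonneg hr]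
    have : 0 ≤ r ^ m * ‖taylorCoeff F m‖ := by positivity
    nlinarith

/-- An entire function with finitely many nonzero Taylor coefficients is a polynomial. -/
theorem exists_polynomial_of_taylorCoeff_eq_zero {F : ℂ → ℂ} (hF : Differentiable ℂ F) {n : ℕ}
    (h : ∀ m, n < m → taylorCoeff F m = 0) :
    ∃ p : Polynomial ℂ, p.natDegree ≤ n ∧ ∀ z, F z = p.eval z := by
  refine ⟨∑ k ∈ Finset.range (n + 1), Polynomial.C (taylorCoeff F k) * Polynomial.X ^ k, ?_, ?_⟩
  · apply Polynomial.natDegree_sum_le_of_forall_le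
    intro k hk
    exact (Polynomial.natDegree_C_mul_X_pow_le _ _).trans (by simpa [Nat.lt_succ_iff] using hk)
  · intro z
    rw [← Complex.taylorSeries_eq_of_entire' 0 z hF, tsum_eq_sum (s := Finset.range (n + 1))]
    · rw [Polynomial.eval_finsetSum]
      refine Finset.sum_congr rfl fun k _ => ?_
      rw [taylorCoeff, Polynomial.eval_mul, Polynomial.eval_C, Polynomial.eval_pow,
        Polynomial.eval_X, sub_zero]
      ring
    · intro k hk
      have := h k (by simpa [Nat.lt_succ_iff] using hk)
      have h2 : (k.factorial : ℂ)⁻¹ * iteratedDeriv k F 0 = 0 := by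
        rw [inv_mul_eq_div]; exact this
      rw [h2, zero_mul]

/-! ### Sign changes on the line. -/

/-- A nonvanishing function on the line with finitely many sign changes has the sign of a
product of linear factors vanishing at these sign changes. -/
theorem exists_subset_prod_sub_sign (Z : Finset ℝ) : ∀ s : ℝ → ℝ,
    (∀ x y, x ∉ Z → y ∉ Z → x ≤ y → (∀ z ∈ Z, z < x ∨ y < z) → 0 < s x * s y) →
    ∃ Z' ⊆ Z, ∃ ε : ℝ, (ε = 1 ∨ ε = -1) ∧ ∀ x ∉ Z, 0 < ε * s x * ∏ z ∈ Z', (x - z) := by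
  induction Z using Finset.induction_on_max with
  | empty =>
    intro s hs
    have h0 : s 0 ≠ 0 := fun h => by simpa [h] using hs 0 0 (by simp) (by simp) le_rfl (by simp)
    have hx : ∀ x, 0 < s 0 * s x := by
      intro x
      rcases le_total 0 x with h | h
      · exact hs 0 x (by simp) (by simp) h (by simp)
      · rw [mul_comm]; exact hs x 0 (by simp) (by simp) h (by simp)
    rcases lt_or_gt_of_ne h0 with h | h
    · exact ⟨∅, by simp, -1, Or.inr rfl, fun x _ => by simp; nlinarith [hx x]⟩
    · exact ⟨∅, by simp, 1, Or.inl rfl, fun x _ => by simp; nlinarith [hx x]⟩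
  | insert m Z hm ih =>
    intro s hs
    -- The point `y0` lies between the other points of `Z` and `m`; it samples the sign just to the
    -- left of `m`.
    obtain ⟨y0, hy0m, hy0⟩ : ∃ y0 < m, ∀ z ∈ Z, z < y0 := by
      have h1 : ∀ᶠ y in nhdsWithin m (Set.Iio m), ∀ z ∈ Z, z < y := by
        rw [Finset.eventually_all]
        exact fun z hz => nhdsWithin_le_nhds (lt_mem_nhds (hm z hz))
      obtain ⟨y, hy1, hy2⟩ := (h1.and self_mem_nhdsWithin).exists
      exact ⟨y, hy2, hy1⟩
    have hy0Z : y0 ∉ Z := fun h => lt_irrefl _ (hy0 _ h)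
    have hins : ∀ x, x ≠ m → x ∉ Z → x ∉ insert m Z := by
      intro x h1 h2; simp [h1, h2]
    have hbetween : ∀ x y, x ∉ Z → y ∉ Z → x ≤ y → y < m → (∀ z ∈ Z, z < x ∨ y < z) →
        0 < s x * s y := by
      intro x y hx hy hxy hym h
      refine hs x y (hins x (hxy.trans_lt hym).ne hx) (hins y hym.ne hy) hxy ?_
      intro z hz
      rcases Finset.mem_insert.1 hz with rfl | hz
      · exact Or.inr hym
      · exact h z hz
    -- Freezing the sign from `m` onwards removes a possible change at `m`, so the induction
    -- hypothesis applies with `Z` alone.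
    set s' : ℝ → ℝ := fun x => if x < m then s x else s y0 with hs'
    obtain ⟨Z', hZ', ε, hε, H⟩ := ih s' (by
      intro x y hx hy hxy h
      simp only [hs']
      split_ifs with h1 h2 h2
      · exact hbetween x y hx hy hxy h2 h
      · rcases le_total x y0 with h3 | h3
        · exact hbetween x y0 hx hy0Z h3 hy0m
            fun z hz => (h z hz).imp_right fun _ => by linarith [hm z hz]
        · rw [mul_comm]
          exact hbetween y0 x hy0Z hx h3 h1 fun z hz => Or.inl (hy0 z hz)
      · linarith
      · exact hbetween y0 y0 hy0Z hy0Z le_rfl hy0m fun z hz => Or.inl (hy0 z hz))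
    have hright : ∀ x y, m < x → m < y → 0 < s x * s y := by
      have : ∀ x y, m < x → x ≤ y → 0 < s x * s y := by
        intro x y hx hxy
        refine hs x y (hins x hx.ne' fun h => ?_) (hins y (by linarith) fun h => ?_) hxy ?_
        · linarith [hm x h]
        · linarith [hm y h]
        · intro z hz
          rcases Finset.mem_insert.1 hz with rfl | hz
          · exact Or.inl hx
          · exact Or.inl ((hm z hz).trans hx)
      intro x y hx hy
      rcases le_total x y with h | h
      · exact this x y hx h
      · rw [mul_comm]; exact this y x hy h
    have hmZ' : m ∉ Z' := fun h => lt_irrefl _ (hm m (hZ' h))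
    have hy0s : 0 < s y0 * s y0 := hbetween y0 y0 hy0Z hy0Z le_rfl hy0m
      fun z hz => Or.inl (hy0 z hz)
    have hleft : ∀ x, x < m → x ∉ Z → 0 < ε * s x * ∏ z ∈ Z', (x - z) := by
      intro x hx hxZ
      simpa [hs', hx] using H x hxZ
    have hmid : ∀ x, m < x → 0 < ε * s y0 * ∏ z ∈ Z', (x - z) := by
      intro x hx
      simpa [hs', hx.not_gt] using H x fun h => by linarith [hm x h]
    have hm1 : s (m + 1) ≠ 0 := fun h => by
      simpa [h] using hright (m + 1) (m + 1) (by linarith) (by linarith)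
    have hy0ne : s y0 ≠ 0 := fun h => by simp [h] at hy0s
    -- If the sign changes at `m`, the factor `x - m` is added; it is negative on the left, whence
    -- the flip of `ε`.
    rcases lt_or_gt_of_ne (mul_ne_zero hm1 hy0ne) with hneg | hpos
    · refine ⟨insert m Z', Finset.insert_subset_insert m hZ', -ε, ?_, ?_⟩
      · rcases hε with rfl | rfl <;> simp
      · intro x hx
        rw [Finset.mem_insert, not_or] at hx
        rw [Finset.prod_insert hmZ']
        rcases lt_or_gt_of_ne hx.1 with h | h
        · have := mul_pos (hleft x h hx.2) (sub_pos.2 h)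
          linarith
        · have h1 := hmid x h
          have h2 := hright x (m + 1) h (by linarith)
          have h3 : s x * s y0 < 0 := by
            by_contra! h4
            have : 0 < s (m + 1) * s (m + 1) := hright _ _ (by linarith) (by linarith)
            nlinarith [mul_pos h2 (neg_pos.2 hneg), mul_nonneg h4 this.le]
          have h5 := mul_pos (mul_pos h1 (neg_pos.2 h3)) (sub_pos.2 h)
          have h6 : 0 < (s y0 * s y0) * (-ε * s x * ((x - m) * ∏ z ∈ Z', (x - z))) := by
            linarith
          exact (mul_pos_iff_of_pos_left hy0s).1 h6
    · refine ⟨Z', hZ'.trans (Finset.subset_insert m Z), ε, hε, ?_⟩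
      intro x hx
      rw [Finset.mem_insert, not_or] at hx
      rcases lt_or_gt_of_ne hx.1 with h | h
      · exact hleft x h hx.2
      · have h1 := hmid x h
        have h2 := hright x (m + 1) h (by linarith)
        have h3 : 0 < s x * s y0 := by
          by_contra! h4
          have : 0 < s (m + 1) * s (m + 1) := hright _ _ (by linarith) (by linarith)
          nlinarith [mul_pos h2 hpos, mul_nonneg (neg_nonneg.2 h4) this.le]
        have h6 : 0 < (s y0 * s y0) * (ε * s x * ∏ z ∈ Z', (x - z)) := by
          have := mul_pos h1 h3
          linarith
        exact (mul_pos_iff_of_pos_left hy0s).1 h6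

/-! ### Sign changes on the circle. -/

theorem exp_mul_I_injOn_Ioo (a : ℝ) :
    Set.InjOn (fun θ : ℝ => Complex.exp (θ * Complex.I)) (Set.Ioo a (a + 2 * Real.pi)) := by
  intro x hx y hy h
  obtain ⟨n, hn⟩ := Complex.exp_eq_exp_iff_exists_int.1 h
  have h1 : x = y + n * (2 * Real.pi) := by
    have := congrArg Complex.im hn
    simpa using this
  have hpi := Real.pi_pos
  have h2 : n = 0 := by
    have h3 : (n : ℝ) < 1 := by
      by_contra! h3
      nlinarith [hx.1, hx.2, hy.1, hy.2]
    have h4 : (-1 : ℝ) < n := by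
      by_contra! h4
      nlinarith [hx.1, hx.2, hy.1, hy.2]
    have h5 : n < 1 := by exact_mod_cast h3
    have h6 : -1 < n := by exact_mod_cast h4
    omega
  simpa [h2] using h1

/-- Separates the phase of a chord from its real signed length, which turns a product of factors `ζ
- s` into a phase times a real product of sines. -/
theorem exp_mul_I_sub_exp_mul_I (x y : ℝ) :
    Complex.exp (x * Complex.I) - Complex.exp (y * Complex.I) =
      2 * Complex.I * Complex.exp ((x / 2 : ℝ) * Complex.I) *
        Complex.exp ((y / 2 : ℝ) * Complex.I) * (Real.sin ((x - y) / 2) : ℝ) := by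
  have h1 : Complex.exp (x * Complex.I) = Complex.exp ((x / 2 : ℝ) * Complex.I) ^ 2 := by
    rw [← Complex.exp_nat_mul]; congr 1; push_cast; ring
  have h2 : Complex.exp (y * Complex.I) = Complex.exp ((y / 2 : ℝ) * Complex.I) ^ 2 := by
    rw [← Complex.exp_nat_mul]; congr 1; push_cast; ring
  have h3 : ((Real.sin ((x - y) / 2) : ℝ) : ℂ) =
      (Complex.exp ((y / 2 : ℝ) * Complex.I) / Complex.exp ((x / 2 : ℝ) * Complex.I) -
      Complex.exp ((x / 2 : ℝ) * Complex.I) / Complex.exp ((y / 2 : ℝ) * Complex.I)) *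
        Complex.I / 2 := by
    rw [Complex.ofReal_sin, Complex.sin, ← Complex.exp_sub, ← Complex.exp_sub]
    congr 4 <;> · push_cast; ring
  have h4 := Complex.exp_ne_zero ((x / 2 : ℝ) * Complex.I)
  have h5 := Complex.exp_ne_zero ((y / 2 : ℝ) * Complex.I)
  rw [h1, h2, h3]
  field_simp
  rw [Complex.I_sq]
  ring

theorem mul_sin_half_nonneg {y : ℝ} (hy : |y| ≤ 2 * Real.pi) : 0 ≤ y * Real.sin (y / 2) := by
  rw [abs_le] at hy
  rcases le_total 0 y with h | h
  · exact mul_nonneg h (Real.sin_nonneg_of_nonneg_of_le_pi (by linarith) (by linarith))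
  · exact mul_nonneg_of_nonpos_of_nonpos h
      (Real.sin_nonpos_of_nonpos_of_neg_pi_le (by linarith) (by linarith))

/-- A continuous real function on the circle with finitely many zeros has the sign of a
trigonometric polynomial whose zeros are zeros of the function. -/
theorem exists_subset_prod_sub_eq_norm {V : ℂ → ℝ} (hV : Continuous V) {S : Finset ℂ}
    (hS : ∀ ζ : ℂ, ‖ζ‖ = 1 → V ζ = 0 → ζ ∈ S) (hne : ∃ ζ : ℂ, ‖ζ‖ = 1 ∧ V ζ ≠ 0) :
    ∃ S' ⊆ S, (∀ ζ ∈ S', ‖ζ‖ = 1 ∧ V ζ = 0) ∧ ∃ d : ℕ, S'.card = 2 * d ∧ ∃ κ : ℂ, ‖κ‖ = 1 ∧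
      ∀ ζ : ℂ, ‖ζ‖ = 1 → κ * (V ζ * ∏ s ∈ S', (ζ - s)) * ζ ^ (-(d : ℤ)) =
        (‖(V ζ : ℂ) * ∏ s ∈ S', (ζ - s)‖ : ℝ) := by
  obtain ⟨ζ₀, hζ₀, hVζ₀⟩ := hne
  have hpi := Real.pi_pos
  set e : ℝ → ℂ := fun θ => Complex.exp (θ * Complex.I) with he
  have hecont : Continuous e := by fun_prop
  have hper : Function.Periodic e (2 * Real.pi) := by
    intro x
    simp only [he]
    rw [Complex.ofReal_add, add_mul, Complex.exp_add]
    simp [Complex.exp_two_pi_mul_I]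
  have henorm : ∀ x, ‖e x‖ = 1 := fun x => Complex.norm_exp_ofReal_mul_I x
  -- The circle is cut open at a point where `V` does not vanish, so no zero sits at an endpoint.
  set a := Complex.arg ζ₀ with ha
  set b := a + 2 * Real.pi with hb
  have hea : e a = ζ₀ := by
    have := Complex.norm_mul_exp_arg_mul_I ζ₀
    simpa [hζ₀] using this
  have heb : e b = ζ₀ := by rw [hb, hper, hea]
  have hinj : Set.InjOn e (Set.Ioo a b) := exp_mul_I_injOn_Ioo a
  have hfin : {θ | θ ∈ Set.Ioo a b ∧ V (e θ) = 0}.Finite := by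
    apply Set.Finite.of_finite_image (f := e)
    · apply S.finite_toSet.subset
      rintro _ ⟨θ, hθ, rfl⟩
      exact hS _ (henorm θ) hθ.2
    · exact hinj.mono fun θ hθ => hθ.1
  set Z := hfin.toFinset with hZdef
  have hZ : ∀ θ, θ ∈ Z ↔ (a < θ ∧ θ < b) ∧ V (e θ) = 0 := by
    intro θ; simp [hZdef]
  -- Clamping to `[a, b]` extends `V ∘ e` by the nonzero constant `V ζ₀`, so all zeros of `w` lie in
  -- `Z`.
  set w : ℝ → ℝ := fun x => V (e (max a (min b x))) with hw
  have hwcont : Continuous w := by fun_prop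
  have hwz : ∀ t, w t = 0 → t ∈ Z := by
    intro t ht
    rcases le_or_gt t a with h | h
    · have : max a (min b t) = a := by
        rw [max_eq_left]; exact (min_le_right _ _).trans h
      simp only [hw, this, hea] at ht
      exact absurd ht hVζ₀
    rcases le_or_gt b t with h' | h'
    · have : max a (min b t) = b := by
        rw [min_eq_left h', max_eq_right]; linarith
      simp only [hw, this, heb] at ht
      exact absurd ht hVζ₀
    · have : max a (min b t) = t := by
        rw [min_eq_right h'.le, max_eq_right h.le]
      simp only [hw, this] at ht
      exact (hZ t).2 ⟨⟨h, h'⟩, ht⟩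
  have hwI : ∀ t, a ≤ t → t ≤ b → w t = V (e t) := by
    intro t h1 h2
    simp only [hw]
    rw [min_eq_right h2, max_eq_right h1]
  obtain ⟨Z', hZ', ε, hε, H⟩ := exists_subset_prod_sub_sign Z w (by
    intro x y hx hy hxy hz
    by_contra! hcon
    have h0 : (0 : ℝ) ∈ Set.uIcc (w x) (w y) := by
      rw [Set.mem_uIcc]
      rcases le_total (w x) 0 with h | h
      · rcases le_total 0 (w y) with h' | h'
        · exact Or.inl ⟨h, h'⟩
        · have h2 : w x = 0 ∨ w y = 0 := mul_eq_zero.1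
            (le_antisymm hcon (mul_nonneg_of_nonpos_of_nonpos h h'))
          rcases h2 with h2 | h2
          · exact absurd (hwz _ h2) hx
          · exact absurd (hwz _ h2) hy
      · rcases le_total (w y) 0 with h' | h'
        · exact Or.inr ⟨h', h⟩
        · have h2 : w x = 0 ∨ w y = 0 := mul_eq_zero.1
            (le_antisymm hcon (mul_nonneg h h'))
          rcases h2 with h2 | h2
          · exact absurd (hwz _ h2) hx
          · exact absurd (hwz _ h2) hy
    obtain ⟨t, ht, ht0⟩ := intermediate_value_uIcc hwcont.continuousOn h0
    rw [Set.uIcc_of_le hxy] at ht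
    rcases hz t (hwz t ht0) with h | h
    · exact absurd ht.1 h.not_ge
    · exact absurd ht.2 h.not_ge)
  have haZ : a ∉ Z := fun h => lt_irrefl _ ((hZ a).1 h).1.1
  have hbZ : b ∉ Z := fun h => lt_irrefl _ ((hZ b).1 h).1.2
  have hab : a ≤ b := by linarith
  -- `w` takes the same value at `a` and `b`, whereas an odd number of linear factors would change
  -- sign between them.
  have heven : Even Z'.card := by
    by_contra hodd
    rw [Nat.not_even_iff_odd] at hodd
    have h1 := H a haZ
    have h2 := H b hbZ
    rw [hwI a le_rfl hab, hea] at h1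
    rw [hwI b hab le_rfl, heb] at h2
    have h3 : 0 < ∏ z ∈ Z', (b - z) :=
      Finset.prod_pos fun z hz => sub_pos.2 ((hZ z).1 (hZ' hz)).1.2
    have h4 : 0 < ∏ z ∈ Z', (z - a) :=
      Finset.prod_pos fun z hz => sub_pos.2 ((hZ z).1 (hZ' hz)).1.1
    have h5 : ∏ z ∈ Z', (a - z) = -∏ z ∈ Z', (z - a) := by
      have : ∀ z ∈ Z', a - z = -1 * (z - a) := fun z _ => by ring
      rw [Finset.prod_congr rfl this, Finset.prod_mul_distrib, Finset.prod_const,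
        hodd.neg_one_pow]
      ring
    rw [h5] at h1
    have h6 : 0 < ε * V ζ₀ := (mul_pos_iff_of_pos_right h3).1 h2
    nlinarith [mul_pos h6 h4]
  obtain ⟨d, hd⟩ := heven
  have hinj' : Set.InjOn e Z' := hinj.mono fun z hz => ((hZ z).1 (hZ' hz)).1
  -- This `κ` cancels the constant phases of the half-angle factorization; the remaining phase `e (θ
  -- / 2) ^ (2 * d) = ζ ^ d` is cancelled by `ζ ^ (-d)`.
  refine ⟨Z'.image e, ?_, ?_, d, ?_, ε / (Complex.I ^ (2 * d) * ∏ z ∈ Z', e (z / 2)), ?_, ?_⟩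
  · intro ζ hζ
    obtain ⟨z, hz, rfl⟩ := Finset.mem_image.1 hζ
    exact hS _ (henorm z) ((hZ z).1 (hZ' hz)).2
  · intro ζ hζ
    obtain ⟨z, hz, rfl⟩ := Finset.mem_image.1 hζ
    exact ⟨henorm z, ((hZ z).1 (hZ' hz)).2⟩
  · rw [Finset.card_image_of_injOn hinj', hd]; ring
  · rw [norm_div, norm_mul, norm_pow, norm_prod]
    simp only [henorm, Complex.norm_I]
    rcases hε with rfl | rfl <;> simp
  · intro ζ hζ
    rw [Finset.prod_image hinj']
    obtain ⟨θ, hθ, hθζ⟩ := hper.exists_mem_Ico Real.two_pi_pos (Complex.arg ζ) a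
    have hζθ : ζ = e θ := by
      rw [← hθζ]
      have := Complex.norm_mul_exp_arg_mul_I ζ
      simpa [hζ] using this.symm
    subst hζθ
    set P : ℂ := ∏ z ∈ Z', e (z / 2) with hP
    have hPnorm : ‖P‖ = 1 := by
      rw [hP, norm_prod]; simp [henorm]
    have hP0 : P ≠ 0 := norm_ne_zero_iff.1 (by rw [hPnorm]; exact one_ne_zero)
    have hprod : ∏ z ∈ Z', (e θ - e z) =
        (2 * Complex.I * e (θ / 2)) ^ (2 * d) * P *
          ((∏ z ∈ Z', Real.sin ((θ - z) / 2) : ℝ) : ℂ) := by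
      rw [Finset.prod_congr rfl fun z _ => exp_mul_I_sub_exp_mul_I θ z, Finset.prod_mul_distrib,
        Finset.prod_mul_distrib, Finset.prod_const, hd, ← two_mul, Complex.ofReal_prod]
    have hhalf : e (θ / 2) ^ 2 = e θ := by
      simp only [he]
      rw [← Complex.exp_nat_mul]; congr 1; push_cast; ring
    have hX : ε / (Complex.I ^ (2 * d) * P) * ((V (e θ) : ℂ) * ∏ z ∈ Z', (e θ - e z)) *
        e θ ^ (-(d : ℤ)) =
        ((ε * V (e θ) * 4 ^ d * ∏ z ∈ Z', Real.sin ((θ - z) / 2) : ℝ) : ℂ) := by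
      have he0 : e θ ≠ 0 := Complex.exp_ne_zero _
      rw [hprod, mul_pow, mul_pow, pow_mul (e (θ / 2)), hhalf, pow_mul 2, zpow_neg, zpow_natCast]
      have hI : Complex.I ^ (2 * d) ≠ 0 := pow_ne_zero _ Complex.I_ne_zero
      push_cast
      field_simp
      norm_num
      ring
    have hnonneg : 0 ≤ ε * V (e θ) * 4 ^ d * ∏ z ∈ Z', Real.sin ((θ - z) / 2) := by
      by_cases hθZ : θ ∈ Z
      · simp [((hZ θ).1 hθZ).2]
      · have h1 := H θ hθZ
        rw [hwI θ hθ.1 hθ.2.le] at h1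
        -- Since `|θ - z| ≤ 2π`, the sine of the half-difference has the sign of the linear factor,
        -- which transfers the sign pattern from the line.
        have h2 : 0 ≤ ∏ z ∈ Z', ((θ - z) * Real.sin ((θ - z) / 2)) := by
          apply Finset.prod_nonneg
          intro z hz
          apply mul_sin_half_nonneg
          have := ((hZ z).1 (hZ' hz)).1
          have h3 := hθ.1
          have h4 := hθ.2
          rw [abs_le]
          constructor <;> linarith
        rw [Finset.prod_mul_distrib] at h2
        have h3 : 0 ≤ (ε * V (e θ) * ∏ z ∈ Z', (θ - z)) *
            (ε * V (e θ) * 4 ^ d * ∏ z ∈ Z', Real.sin ((θ - z) / 2)) := by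
          have : 0 ≤ (ε * V (e θ)) ^ 2 * 4 ^ d := by positivity
          have := mul_nonneg this h2
          linarith
        exact nonneg_of_mul_nonneg_right h3 h1
    have hnorm := congrArg norm hX
    rw [Complex.norm_real, Real.norm_eq_abs, abs_of_nonneg hnonneg] at hnorm
    rw [hX, ← hnorm, norm_mul, norm_mul, norm_div, norm_zpow, henorm, norm_mul, norm_pow,
      Complex.norm_I, hPnorm, Complex.norm_real]
    rcases hε with rfl | rfl <;> simp

/-! ### Control of a Fourier coefficient by lower ones. -/

theorem norm_circleCoeff_natAbs (V : ℂ → ℝ) (k : ℤ) :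
    ‖circleCoeff V k‖ = ‖circleCoeff V k.natAbs‖ := by
  rcases Int.natAbs_eq k with h | h
  · rw [← h]
  · conv_lhs => rw [h, norm_circleCoeff_neg]

theorem integral_mul_eval_mul_zpow {V : ℂ → ℝ} (hV : Continuous V) (Q : Polynomial ℂ) {N : ℕ}
    (hQ : Q.natDegree < N) (k : ℤ) :
    ∫ θ in (0 : ℝ)..2 * Real.pi, (V (Complex.exp (θ * Complex.I)) : ℂ) *
      Q.eval (Complex.exp (θ * Complex.I)) * Complex.exp (θ * Complex.I) ^ (-k) =
      ∑ j ∈ Finset.range N, Q.coeff j * circleCoeff V (k - j) := by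
  unfold circleCoeff
  simp_rw [← intervalIntegral.integral_const_mul]
  rw [← intervalIntegral.integral_finsetSum]
  · congr 1
    ext θ
    rw [Polynomial.eval_eq_sum_range' hQ, Finset.mul_sum, Finset.sum_mul]
    refine Finset.sum_congr rfl fun j _ => ?_
    rw [neg_sub, sub_eq_add_neg, zpow_add₀ (Complex.exp_ne_zero _), zpow_natCast]
    ring
  · intro j _
    have := continuous_exp_mul_I_zpow (-(k - j))
    exact Continuous.intervalIntegrable (by fun_prop) _ _

/-- If `V` has the sign of a trigonometric polynomial of degree `d` on the unit circle and `U` is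
dominated by `V`, then every Fourier coefficient of `U` of index larger than `d` is controlled by
the lower ones. -/
theorem norm_circleCoeff_le {U V : ℂ → ℝ} (hU : Continuous U) (hV : Continuous V) {A : ℝ}
    (hA : 0 ≤ A) (hUV : ∀ ζ : ℂ, ‖ζ‖ = 1 → |U ζ| ≤ A * |V ζ|) {S : Finset ℂ}
    (hS : ∀ s ∈ S, ‖s‖ = 1) {n d m : ℕ} (hcard : S.card = 2 * d) (hdn : d ≤ n) (hdm : d < m)
    {κ : ℂ} (hκ : ‖κ‖ = 1)
    (hsign : ∀ ζ : ℂ, ‖ζ‖ = 1 → κ * (V ζ * ∏ s ∈ S, (ζ - s)) * ζ ^ (-(d : ℤ)) =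
        (‖(V ζ : ℂ) * ∏ s ∈ S, (ζ - s)‖ : ℝ))
    {M : ℝ} (hMV : ∀ k ≤ d, ‖circleCoeff V k‖ ≤ M) (hMU : ∀ k < m, ‖circleCoeff U k‖ ≤ M) :
    ‖circleCoeff U m‖ ≤ (1 + A) * ((2 * n + 1) * ((2 * n).choose n * M)) := by
  have hpi := Real.pi_pos
  have hM : 0 ≤ M := (norm_nonneg _).trans (hMV 0 (Nat.zero_le _))
  set Q : Polynomial ℂ := ∏ s ∈ S, (Polynomial.X - Polynomial.C s) with hQ
  have hQeval : ∀ ζ, Q.eval ζ = ∏ s ∈ S, (ζ - s) := by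
    intro ζ; simp [hQ, Polynomial.eval_prod]
  have hQmonic : Q.Monic := Polynomial.monic_prod_of_monic _ _ fun s _ => Polynomial.monic_X_sub_C s
  have hQdeg : Q.natDegree = 2 * d := by
    rw [hQ, Polynomial.natDegree_finsetProd_X_sub_C_eq_card, hcard]
  have hQroots : ∀ z ∈ Q.roots, ‖z‖ ≤ 1 := by
    intro z hz
    rw [hQ, Polynomial.roots_prod_X_sub_C] at hz
    exact (hS z hz).le
  -- The roots have modulus one and the degree is at most `2 * n`, so the bound depends neither on
  -- `S` nor, later, on the radius.
  have hcoeff : ∀ j, ‖Q.coeff j‖ ≤ (2 * n).choose n := by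
    intro j
    have := Polynomial.coeff_bdd_of_roots_le (B := 1) (d := 2 * n) (RingHom.id ℂ) hQmonic
      (IsAlgClosed.splits _) (by omega) (by simpa using hQroots) j
    simpa using this
  have hcoeff0 : ‖Q.coeff 0‖ = 1 := by
    rw [Polynomial.coeff_zero_eq_eval_zero, hQeval, norm_prod]
    simp only [zero_sub, norm_neg]
    exact Finset.prod_eq_one hS
  set B : ℝ := (((2 * n).choose n : ℕ) : ℝ) with hB
  have hB0 : 0 ≤ B := Nat.cast_nonneg _
  have henorm : ∀ x : ℝ, ‖Complex.exp (x * Complex.I)‖ = 1 := Complex.norm_exp_ofReal_mul_I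
  have hnV : ‖∫ θ in (0 : ℝ)..2 * Real.pi, (V (Complex.exp (θ * Complex.I)) : ℂ) *
      Q.eval (Complex.exp (θ * Complex.I)) * Complex.exp (θ * Complex.I) ^ (-(d : ℤ))‖ ≤
      (2 * d + 1) * (B * M) := by
    rw [integral_mul_eval_mul_zpow hV Q (N := 2 * d + 1) (by omega)]
    refine (norm_sum_le_of_le (n := fun _ => B * M) _ ?_).trans (by simp)
    intro j hj
    rw [norm_mul, norm_circleCoeff_natAbs]
    -- For `0 ≤ j ≤ 2d` one has `|d - j| ≤ d`.
    refine mul_le_mul (hcoeff j) (hMV _ ?_) (norm_nonneg _) hB0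
    rw [Finset.mem_range] at hj
    omega
  have hint : ∫ θ in (0 : ℝ)..2 * Real.pi, ‖(V (Complex.exp (θ * Complex.I)) : ℂ) *
      Q.eval (Complex.exp (θ * Complex.I))‖ ≤ (2 * d + 1) * (B * M) := by
    refine le_trans (le_of_eq ?_) hnV
    -- By `hsign` the integrand is its own absolute value, so one Fourier coefficient computes the
    -- L¹ norm.
    have h1 : κ * ∫ θ in (0 : ℝ)..2 * Real.pi, (V (Complex.exp (θ * Complex.I)) : ℂ) *
        Q.eval (Complex.exp (θ * Complex.I)) * Complex.exp (θ * Complex.I) ^ (-(d : ℤ)) =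
        ((∫ θ in (0 : ℝ)..2 * Real.pi, ‖(V (Complex.exp (θ * Complex.I)) : ℂ) *
          Q.eval (Complex.exp (θ * Complex.I))‖ : ℝ) : ℂ) := by
      rw [← intervalIntegral.integral_const_mul, ← intervalIntegral.integral_ofReal]
      congr 1
      ext θ
      rw [hQeval, ← hsign _ (henorm θ)]
      ring
    have h2 := congrArg norm h1
    rw [norm_mul, hκ, one_mul, Complex.norm_real, Real.norm_eq_abs, abs_of_nonneg] at h2
    · exact h2.symm
    · exact intervalIntegral.integral_nonneg (by positivity) fun _ _ => norm_nonneg _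
  have hnU : ‖∫ θ in (0 : ℝ)..2 * Real.pi, (U (Complex.exp (θ * Complex.I)) : ℂ) *
      Q.eval (Complex.exp (θ * Complex.I)) * Complex.exp (θ * Complex.I) ^ (-(m : ℤ))‖ ≤
      A * ((2 * d + 1) * (B * M)) := by
    refine le_trans ?_ (mul_le_mul_of_nonneg_left hint hA)
    rw [← intervalIntegral.integral_const_mul]
    apply intervalIntegral.norm_integral_le_of_norm_le (by positivity)
    · filter_upwards with θ _
      rw [norm_mul, norm_zpow, henorm, one_zpow, mul_one, norm_mul, norm_mul, Complex.norm_real,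
        Complex.norm_real, ← mul_assoc]
      exact mul_le_mul_of_nonneg_right (hUV _ (henorm θ)) (norm_nonneg _)
    · exact Continuous.intervalIntegrable (by fun_prop) _ _
  rw [integral_mul_eval_mul_zpow hU Q (N := 2 * d + 1) (by omega), Finset.sum_range_succ'] at hnU
  have hrest : ‖∑ j ∈ Finset.range (2 * d), Q.coeff (j + 1) *
      circleCoeff U (m - ((j + 1 : ℕ) : ℤ))‖ ≤ 2 * d * (B * M) := by
    refine (norm_sum_le_of_le (n := fun _ => B * M) _ ?_).trans (by simp)
    intro j hj
    rw [norm_mul, norm_circleCoeff_natAbs]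
    -- The shift satisfies `1 ≤ j + 1 ≤ 2d < 2m`, so `|m - (j + 1)| < m`.
    refine mul_le_mul (hcoeff _) (hMU _ ?_) (norm_nonneg _) hB0
    rw [Finset.mem_range] at hj
    omega
  have hfinal : ‖circleCoeff U m‖ = ‖Q.coeff 0 * circleCoeff U (m - ((0 : ℕ) : ℤ))‖ := by
    rw [norm_mul, hcoeff0]; simp
  rw [hfinal]
  have h3 := norm_le_add_norm_add (Q.coeff 0 * circleCoeff U (m - ((0 : ℕ) : ℤ)))
    (∑ j ∈ Finset.range (2 * d), Q.coeff (j + 1) * circleCoeff U (m - ((j + 1 : ℕ) : ℤ)))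
  rw [add_comm (Q.coeff 0 * _)] at h3
  have hd : (d : ℝ) ≤ n := by exact_mod_cast hdn
  have hBM : 0 ≤ B * M := mul_nonneg hB0 hM
  have h4 : (2 * d + 1) * (B * M) ≤ (2 * n + 1) * (B * M) := by gcongr
  nlinarith [mul_le_mul_of_nonneg_left h4 hA]

/-! ### Growth on large circles and trigonometric polynomials. -/

theorem eq_zero_of_forall_pow_mul_le {x C r₀ : ℝ} (hx : 0 ≤ x) {n m : ℕ} (hnm : n < m)
    (h : ∀ r, r₀ ≤ r → 1 ≤ r → r ^ m * x ≤ C * r ^ n) : x = 0 := by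
  by_contra hne
  have hx' : 0 < x := lt_of_le_of_ne hx (Ne.symm hne)
  set r := max (max r₀ 1) (C / x + 1) with hr
  have h0 : r₀ ≤ r := (le_max_left _ _).trans (le_max_left _ _)
  have h1 : 1 ≤ r := (le_max_right _ _).trans (le_max_left _ _)
  have h2 : C / x + 1 ≤ r := le_max_right _ _
  have h3 : C / x < r := by linarith
  rw [div_lt_iff₀ hx'] at h3
  have h4 := h r h0 h1
  have h5 : r ^ (n + 1) ≤ r ^ m := pow_le_pow_right₀ h1 hnm
  have h6 : 0 < r ^ n := by positivity
  have h7 := mul_le_mul_of_nonneg_right h5 hx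
  rw [pow_succ] at h7
  nlinarith [mul_lt_mul_of_pos_left h3 h6]

theorem MvPolynomial.exists_abs_eval_re_im_le (P : MvPolynomial (Fin 2) ℝ) :
    ∃ (C : ℝ) (N : ℕ), 0 ≤ C ∧
      ∀ z : ℂ, 1 ≤ ‖z‖ → |MvPolynomial.eval ![z.re, z.im] P| ≤ C * ‖z‖ ^ N := by
  induction P using MvPolynomial.induction_on with
  | C c => exact ⟨|c|, 0, abs_nonneg c, fun z _ => by simp⟩
  | add p q hp hq =>
    obtain ⟨C₁, N₁, h₁, H₁⟩ := hp
    obtain ⟨C₂, N₂, h₂, H₂⟩ := hq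
    refine ⟨C₁ + C₂, max N₁ N₂, add_nonneg h₁ h₂, fun z hz => ?_⟩
    rw [map_add, add_mul]
    refine (abs_add_le _ _).trans (add_le_add ((H₁ z hz).trans ?_) ((H₂ z hz).trans ?_))
    · exact mul_le_mul_of_nonneg_left (pow_le_pow_right₀ hz (le_max_left _ _)) h₁
    · exact mul_le_mul_of_nonneg_left (pow_le_pow_right₀ hz (le_max_right _ _)) h₂
  | mul_X p i hp =>
    obtain ⟨C, N, h, H⟩ := hp
    refine ⟨C, N + 1, h, fun z hz => ?_⟩
    rw [map_mul, MvPolynomial.eval_X, abs_mul, pow_succ, ← mul_assoc]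
    refine mul_le_mul (H z hz) ?_ (abs_nonneg _) (by positivity)
    fin_cases i
    · exact Complex.abs_re_le_norm z
    · exact Complex.abs_im_le_norm z

theorem norm_circleCoeff_le_of_bound {V : ℂ → ℝ} {B : ℝ} (h : ∀ ζ : ℂ, ‖ζ‖ = 1 → |V ζ| ≤ B)
    (k : ℤ) : ‖circleCoeff V k‖ ≤ B * (2 * Real.pi) := by
  have hpi := Real.pi_pos
  have := intervalIntegral.norm_integral_le_of_norm_le_const (C := B) (a := 0) (b := 2 * Real.pi)
    (f := fun θ : ℝ => (V (Complex.exp (θ * Complex.I)) : ℂ) *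
      Complex.exp (θ * Complex.I) ^ (-k)) (by
    intro θ _
    have hn := Complex.norm_exp_ofReal_mul_I θ
    rw [norm_mul, norm_zpow, hn, one_zpow, mul_one, Complex.norm_real]
    exact h _ hn)
  rwa [sub_zero, abs_of_pos (by positivity)] at this

theorem circleCoeff_eq_zero_of_eq_zero {V : ℂ → ℝ} (h : ∀ ζ : ℂ, ‖ζ‖ = 1 → V ζ = 0) (k : ℤ) :
    circleCoeff V k = 0 := by
  have := norm_circleCoeff_le_of_bound (V := V) (B := 0) (fun ζ hζ => by simp [h ζ hζ]) k
  simpa using this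

/-- If the real part of an entire function is a polynomial, then so is the function. -/
theorem exists_taylorCoeff_eq_zero_of_isPlanePolynomial {F : ℂ → ℂ} (hF : Differentiable ℂ F)
    (hu : IsPlanePolynomial fun z => (F z).re) : ∃ N, ∀ m, N < m → taylorCoeff F m = 0 := by
  obtain ⟨P, hP⟩ := hu
  obtain ⟨C, N, hC, H⟩ := P.exists_abs_eval_re_im_le
  have hpi := Real.pi_pos
  refine ⟨N, fun m hm => ?_⟩
  rw [← norm_eq_zero]
  refine eq_zero_of_forall_pow_mul_le (C := 2 * C) (r₀ := 1) (norm_nonneg _) hm fun r _ hr => ?_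
  have h1 := norm_circleCoeff_le_of_bound (V := fun z => (F (r * z)).re) (B := C * r ^ N) (by
    intro ζ hζ
    have hn : ‖(r : ℂ) * ζ‖ = r := by
      rw [norm_mul, hζ, mul_one, Complex.norm_real, Real.norm_eq_abs, abs_of_nonneg (by linarith)]
    have := H (r * ζ) (by rwa [hn])
    rw [hn, ← hP] at this
    exact this) m
  rw [circleCoeff_re_of_pos hF r (by omega)] at h1
  simp only [norm_mul, norm_pow, Complex.norm_real, Real.norm_eq_abs, abs_of_pos hpi,
    abs_of_nonneg (zero_le_one.trans hr)] at h1
  nlinarith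

/-- On a circle, the real part of a polynomial of degree at most `n` is a trigonometric polynomial
of degree at most `n`. -/
theorem exists_polynomial_eval_eq_pow_mul_re {F : ℂ → ℂ} (hF : Differentiable ℂ F) {n : ℕ}
    (hn : n ≠ 0) (h : ∀ m, n < m → taylorCoeff F m = 0) (r : ℝ) :
    ∃ T : Polynomial ℂ, T.natDegree ≤ 2 * n ∧ T.coeff (2 * n) = r ^ n * taylorCoeff F n ∧
      ∀ ζ : ℂ, ‖ζ‖ = 1 → T.eval ζ = ζ ^ n * (2 * (F (r * ζ)).re) := by
  set c : ℕ → ℂ := fun k => r ^ k * taylorCoeff F k with hc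
  have hsum : ∀ ζ : ℂ, F (r * ζ) = ∑ k ∈ Finset.range (n + 1), c k * ζ ^ k := by
    intro ζ
    rw [← Complex.taylorSeries_eq_of_entire' 0 (r * ζ) hF,
      tsum_eq_sum (s := Finset.range (n + 1))]
    · refine Finset.sum_congr rfl fun k _ => ?_
      simp only [hc, sub_zero, taylorCoeff]
      ring
    · intro k hk
      have h1 := h k (by simpa [Nat.lt_succ_iff] using hk)
      have h2 : (k.factorial : ℂ)⁻¹ * iteratedDeriv k F 0 = 0 := by
        rw [inv_mul_eq_div]; exact h1
      rw [h2, zero_mul]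
  -- On the unit circle `conj ζ = ζ⁻¹`, so multiplying `F + conj F` by `ζ ^ n` clears the negative
  -- powers.
  refine ⟨∑ k ∈ Finset.range (n + 1), (Polynomial.C (c k) * Polynomial.X ^ (n + k) +
    Polynomial.C ((starRingEnd ℂ) (c k)) * Polynomial.X ^ (n - k)), ?_, ?_, ?_⟩
  · apply Polynomial.natDegree_sum_le_of_forall_le
    intro k hk
    rw [Finset.mem_range] at hk
    apply Polynomial.natDegree_add_le_of_degree_le
    · exact (Polynomial.natDegree_C_mul_X_pow_le _ _).trans (by omega)
    · exact (Polynomial.natDegree_C_mul_X_pow_le _ _).trans (by omega)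
  · rw [Polynomial.finsetSum_coeff, Finset.sum_eq_single n]
    · rw [Polynomial.coeff_add, Polynomial.coeff_C_mul_X_pow, Polynomial.coeff_C_mul_X_pow,
        if_pos (two_mul n), if_neg (by omega), add_zero]
    · intro k hk hkn
      rw [Finset.mem_range] at hk
      rw [Polynomial.coeff_add, Polynomial.coeff_C_mul_X_pow, Polynomial.coeff_C_mul_X_pow,
        if_neg (by omega), if_neg (by omega), add_zero]
    · intro hk
      exact absurd (Finset.mem_range.2 (Nat.lt_succ_self n)) hk
  · intro ζ hζ
    have hζ0 : ζ ≠ 0 := norm_ne_zero_iff.1 (by rw [hζ]; exact one_ne_zero)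
    have hconj : (starRingEnd ℂ) ζ = ζ⁻¹ := by
      rw [Complex.inv_def, Complex.normSq_eq_norm_sq, hζ]; simp
    rw [Complex.re_eq_add_conj, mul_div_cancel₀ _ two_ne_zero, hsum, map_sum,
      ← Finset.sum_add_distrib, Finset.mul_sum, Polynomial.eval_finsetSum]
    refine Finset.sum_congr rfl fun k hk => ?_
    rw [Finset.mem_range] at hk
    simp only [Polynomial.eval_add, Polynomial.eval_mul, Polynomial.eval_C, Polynomial.eval_pow,
      Polynomial.eval_X, map_mul, map_pow, hconj]
    rw [pow_sub₀ ζ hζ0 (by omega), pow_add, inv_pow]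
    ring

/-! ### Consequences of domination near infinity. -/

/-- If the real part of `F` is dominated on a circle by that of `G`, then the latter has on this
circle the sign of a trigonometric polynomial of degree at most that of `F`. -/
theorem exists_sign_trigonometric {F G : ℂ → ℂ} (hF : Differentiable ℂ F) (hG : Differentiable ℂ G)
    {n : ℕ} (hn : n ≠ 0) (h : ∀ m, n < m → taylorCoeff F m = 0) (hFn : taylorCoeff F n ≠ 0)
    {a r : ℝ} (hr : 0 < r)
    (hFG : ∀ ζ : ℂ, ‖ζ‖ = 1 → |(F (r * ζ)).re| ≤ a * |(G (r * ζ)).re|) :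
    ∃ S : Finset ℂ, (∀ s ∈ S, ‖s‖ = 1 ∧ (G (r * s)).re = 0) ∧ ∃ d ≤ n, S.card = 2 * d ∧
      ∃ κ : ℂ, ‖κ‖ = 1 ∧ ∀ ζ : ℂ, ‖ζ‖ = 1 →
        κ * ((G (r * ζ)).re * ∏ s ∈ S, (ζ - s)) * ζ ^ (-(d : ℤ)) =
        (‖((G (r * ζ)).re : ℂ) * ∏ s ∈ S, (ζ - s)‖ : ℝ) := by
  obtain ⟨T, hT1, hT2, hT3⟩ := exists_polynomial_eval_eq_pow_mul_re hF hn h r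
  have hr0 : (r : ℂ) ≠ 0 := by exact_mod_cast hr.ne'
  have hT0 : T ≠ 0 := by
    rintro rfl
    rw [Polynomial.coeff_zero] at hT2
    exact mul_ne_zero (pow_ne_zero n hr0) hFn hT2.symm
  have hzero : ∀ ζ : ℂ, ‖ζ‖ = 1 → (G (r * ζ)).re = 0 → (F (r * ζ)).re = 0 := by
    intro ζ hζ h0
    have := hFG ζ hζ
    rw [h0, abs_zero, mul_zero] at this
    exact abs_nonpos_iff.1 this
  have hGc := hG.continuous
  obtain ⟨S, hS, hS1, d, hd, κ, hκ, H⟩ := exists_subset_prod_sub_eq_norm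
    (V := fun ζ => (G (r * ζ)).re) (S := T.roots.toFinset) (by fun_prop) (by
      intro ζ hζ h0
      rw [Multiset.mem_toFinset, Polynomial.mem_roots hT0, Polynomial.IsRoot, hT3 ζ hζ,
        hzero ζ hζ h0]
      simp) (by
      -- If `Re G` vanished on the whole circle, so would `Re F`, against `taylorCoeff F n ≠ 0`.
      by_contra! hcon
      have := circleCoeff_eq_zero_of_eq_zero (V := fun ζ => (F (r * ζ)).re)
        (fun ζ hζ => hzero ζ hζ (hcon ζ hζ)) n
      rw [circleCoeff_re_of_pos hF r hn] at this
      have hpi : (Real.pi : ℂ) ≠ 0 := by exact_mod_cast Real.pi_ne_zero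
      exact mul_ne_zero hpi (mul_ne_zero (pow_ne_zero n hr0) hFn) this)
  refine ⟨S, hS1, d, ?_, hd, κ, hκ, H⟩
  have h1 := Finset.card_le_card hS
  have h2 := T.roots.toFinset_card_le
  have h3 := T.card_roots'
  omega

/-- If the real part of a polynomial `F` is dominated near infinity by the real part of an entire
function `G`, then the degree of `G` is at most that of `F`. -/
theorem taylorCoeff_eq_zero_of_dominated {F G : ℂ → ℂ} (hF : Differentiable ℂ F)
    (hG : Differentiable ℂ G) {n : ℕ} (hn : n ≠ 0) (h : ∀ m, n < m → taylorCoeff F m = 0)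
    (hFn : taylorCoeff F n ≠ 0) {a R : ℝ}
    (hFG : ∀ z : ℂ, R ≤ ‖z‖ → |(F z).re| ≤ a * |(G z).re|) :
    ∀ m, n < m → taylorCoeff G m = 0 := by
  have hpi := Real.pi_pos
  have hGc := hG.continuous
  intro m
  induction m using Nat.strong_induction_on with
  | _ m ih =>
  intro hm
  set K : ℝ := ∑ k ∈ Finset.range (n + 1), ‖taylorCoeff G k‖ with hK
  rw [← norm_eq_zero]
  refine eq_zero_of_forall_pow_mul_le
    (C := (1 + 1) * ((2 * n + 1) * ((2 * n).choose n * (2 * K)))) (r₀ := R)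
    (norm_nonneg _) hm fun r hr hr1 => ?_
  have hr0 : 0 ≤ r := zero_le_one.trans hr1
  have hnorm : ∀ ζ : ℂ, ‖ζ‖ = 1 → ‖(r : ℂ) * ζ‖ = r := by
    intro ζ hζ
    rw [norm_mul, hζ, mul_one, Complex.norm_real, Real.norm_eq_abs, abs_of_nonneg hr0]
  obtain ⟨S, hS, d, hdn, hd, κ, hκ, H⟩ := exists_sign_trigonometric hF hG hn h hFn
    (zero_lt_one.trans_le hr1) (fun ζ hζ => hFG (r * ζ) (by rwa [hnorm ζ hζ]))
  have hlow : ∀ k < m, ‖circleCoeff (fun ζ => (G (r * ζ)).re) k‖ ≤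
      2 * Real.pi * (r ^ n * K) := by
    intro k hk
    refine (norm_circleCoeff_re_le hG hr0 k).trans ?_
    -- Indices up to `n` grow at most like `r ^ n`; those strictly between `n` and `m` vanish by
    -- induction.
    rcases le_or_gt k n with hkn | hkn
    · gcongr
      · exact Finset.single_le_sum (f := fun k => ‖taylorCoeff G k‖) (fun _ _ => norm_nonneg _)
          (Finset.mem_range.2 (by omega))
    · rw [ih k hk hkn]
      simp only [norm_zero, mul_zero]
      positivity
  have h1 := norm_circleCoeff_le (U := fun ζ => (G (r * ζ)).re) (V := fun ζ => (G (r * ζ)).re)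
    (by fun_prop) (by fun_prop) zero_le_one (fun ζ _ => by rw [one_mul])
    (fun s hs => (hS s hs).1) hd hdn (hdn.trans_lt hm) hκ H
    (fun k hk => hlow k (hk.trans_lt (hdn.trans_lt hm))) hlow
  rw [circleCoeff_re_of_pos hG r (by omega)] at h1
  simp only [norm_mul, norm_pow, Complex.norm_real, Real.norm_eq_abs, abs_of_pos hpi,
    abs_of_nonneg hr0] at h1
  refine le_of_mul_le_mul_left ?_ hpi
  linarith

/-- In the same situation, on some large circle the real part of `G` has `2n` zeros, where `n` is
the degree of `F`. -/
theorem exists_card_zeros_of_dominated {F G : ℂ → ℂ} (hF : Differentiable ℂ F)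
    (hG : Differentiable ℂ G) {n : ℕ} (hn : n ≠ 0) (h : ∀ m, n < m → taylorCoeff F m = 0)
    (hFn : taylorCoeff F n ≠ 0) {a R : ℝ} (ha : 0 ≤ a)
    (hFG : ∀ z : ℂ, R ≤ ‖z‖ → |(F z).re| ≤ a * |(G z).re|) :
    ∃ r : ℝ, R ≤ r ∧ 0 < r ∧ ∃ S : Finset ℂ, S.card = 2 * n ∧
      ∀ s ∈ S, ‖s‖ = 1 ∧ (G (r * s)).re = 0 := by
  have hpi := Real.pi_pos
  have hFc := hF.continuous
  have hGc := hG.continuous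
  by_contra! hcon
  apply hFn
  set K : ℝ := ∑ k ∈ Finset.range (n + 1), (‖taylorCoeff F k‖ + ‖taylorCoeff G k‖) with hK
  have hK' : ∀ k ≤ n, ‖taylorCoeff F k‖ + ‖taylorCoeff G k‖ ≤ K := fun k hk =>
    Finset.single_le_sum (f := fun k => ‖taylorCoeff F k‖ + ‖taylorCoeff G k‖)
      (fun _ _ => by positivity) (Finset.mem_range.2 (by omega))
  rw [← norm_eq_zero]
  -- If `d < n` on every large circle, only coefficients of index at most `n - 1` enter the bound
  -- for index `n`.
  refine eq_zero_of_forall_pow_mul_le (n := n - 1) (m := n)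
    (C := (1 + a) * ((2 * n + 1) * ((2 * n).choose n * (2 * K)))) (r₀ := R)
    (norm_nonneg _) (by omega) fun r hr hr1 => ?_
  have hr0 : 0 ≤ r := zero_le_one.trans hr1
  have hnorm : ∀ ζ : ℂ, ‖ζ‖ = 1 → ‖(r : ℂ) * ζ‖ = r := by
    intro ζ hζ
    rw [norm_mul, hζ, mul_one, Complex.norm_real, Real.norm_eq_abs, abs_of_nonneg hr0]
  have hFGr : ∀ ζ : ℂ, ‖ζ‖ = 1 → |(F (r * ζ)).re| ≤ a * |(G (r * ζ)).re| :=
    fun ζ hζ => hFG (r * ζ) (by rwa [hnorm ζ hζ])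
  obtain ⟨S, hS, d, hdn, hd, κ, hκ, H⟩ := exists_sign_trigonometric hF hG hn h hFn
    (zero_lt_one.trans_le hr1) hFGr
  have hdlt : d < n := by
    refine lt_of_le_of_ne hdn ?_
    rintro rfl
    obtain ⟨s, hs, hs'⟩ := hcon r hr (by linarith) S hd
    exact hs' (hS s hs).1 (hS s hs).2
  have hlowF : ∀ k < n, ‖circleCoeff (fun ζ => (F (r * ζ)).re) k‖ ≤
      2 * Real.pi * (r ^ (n - 1) * K) := by
    intro k hk
    refine (norm_circleCoeff_re_le hF hr0 k).trans ?_
    gcongr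
    · omega
    · have := hK' k hk.le
      linarith [norm_nonneg (taylorCoeff G k)]
  have hlowG : ∀ k ≤ d, ‖circleCoeff (fun ζ => (G (r * ζ)).re) k‖ ≤
      2 * Real.pi * (r ^ (n - 1) * K) := by
    intro k hk
    refine (norm_circleCoeff_re_le hG hr0 k).trans ?_
    gcongr
    · omega
    · have := hK' k (hk.trans hdn)
      linarith [norm_nonneg (taylorCoeff F k)]
  have h1 := norm_circleCoeff_le (U := fun ζ => (F (r * ζ)).re) (V := fun ζ => (G (r * ζ)).re)
    (by fun_prop) (by fun_prop) ha hFGr (fun s hs => (hS s hs).1) hd hdn hdlt hκ H hlowG hlowF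
  rw [circleCoeff_re_of_pos hF r hn] at h1
  simp only [norm_mul, norm_pow, Complex.norm_real, Real.norm_eq_abs, abs_of_pos hpi,
    abs_of_nonneg hr0] at h1
  refine le_of_mul_le_mul_left ?_ hpi
  linarith

/-- All Fourier coefficients on the circle vanish, hence so do the Taylor coefficients of positive
index, and `H` is constant. -/
theorem re_eq_zero_of_re_eq_zero_on_circle {H : ℂ → ℂ} (hH : Differentiable ℂ H) {r : ℝ}
    (hr : 0 < r) (h : ∀ ζ : ℂ, ‖ζ‖ = 1 → (H (r * ζ)).re = 0) (z : ℂ) : (H z).re = 0 := by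
  obtain ⟨p, hp, hpH⟩ := exists_polynomial_of_taylorCoeff_eq_zero hH (n := 0) (by
    intro m hm
    have h1 := circleCoeff_re_of_pos hH r hm.ne'
    rw [circleCoeff_eq_zero_of_eq_zero h] at h1
    have hpi : (Real.pi : ℂ) ≠ 0 := by exact_mod_cast Real.pi_ne_zero
    have hr0 : (r : ℂ) ≠ 0 := by exact_mod_cast hr.ne'
    simpa [hpi, hr0] using h1.symm)
  rw [Polynomial.eq_C_of_natDegree_le_zero hp] at hpH
  have h1 := h 1 norm_one
  rw [hpH, Polynomial.eval_C] at h1 ⊢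
  exact h1

/-- If the real part of a polynomial `F` is dominated near infinity by the real part of an entire
function `G`, then both real parts are proportional. -/
theorem exists_re_eq_mul_re_of_dominated {F G : ℂ → ℂ} (hF : Differentiable ℂ F)
    (hG : Differentiable ℂ G) {n : ℕ} (hn : n ≠ 0) (h : ∀ m, n < m → taylorCoeff F m = 0)
    (hFn : taylorCoeff F n ≠ 0) {a R : ℝ} (ha : 0 ≤ a)
    (hFG : ∀ z : ℂ, R ≤ ‖z‖ → |(F z).re| ≤ a * |(G z).re|) :
    ∃ b : ℝ, |b| ≤ a ∧ ∀ z, (F z).re = b * (G z).re := by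
  have hGz := taylorCoeff_eq_zero_of_dominated hF hG hn h hFn hFG
  obtain ⟨r, hrR, hr, S, hcard, hS⟩ := exists_card_zeros_of_dominated hF hG hn h hFn ha hFG
  have hnorm : ∀ ζ : ℂ, ‖ζ‖ = 1 → ‖(r : ℂ) * ζ‖ = r := by
    intro ζ hζ
    rw [norm_mul, hζ, mul_one, Complex.norm_real, Real.norm_eq_abs, abs_of_pos hr]
  have hFGr : ∀ ζ : ℂ, ‖ζ‖ = 1 → |(F (r * ζ)).re| ≤ a * |(G (r * ζ)).re| :=
    fun ζ hζ => hFG (r * ζ) (by rwa [hnorm ζ hζ])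
  have hr0 : (r : ℂ) ≠ 0 := by exact_mod_cast hr.ne'
  have hpi : (Real.pi : ℂ) ≠ 0 := by exact_mod_cast Real.pi_ne_zero
  have hzero : ∀ ζ : ℂ, ‖ζ‖ = 1 → (G (r * ζ)).re = 0 → (F (r * ζ)).re = 0 := by
    intro ζ hζ h0
    have := hFGr ζ hζ
    rw [h0, abs_zero, mul_zero] at this
    exact abs_nonpos_iff.1 this
  obtain ⟨T₁, hT₁deg, hT₁, hT₁eval⟩ := exists_polynomial_eval_eq_pow_mul_re hF hn h r
  obtain ⟨T₂, hT₂deg, hT₂, hT₂eval⟩ := exists_polynomial_eval_eq_pow_mul_re hG hn hGz r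
  -- This combination cancels the coefficients of degree `2 * n`, so the `2 * n` common zeros in `S`
  -- force it to vanish.
  set D : Polynomial ℂ := Polynomial.C (taylorCoeff G n) * T₁ - Polynomial.C (taylorCoeff F n) * T₂
    with hD
  have hDdeg : D.natDegree < 2 * n := by
    have hle : D.natDegree ≤ 2 * n :=
      (Polynomial.natDegree_sub_le_of_le (Polynomial.natDegree_C_mul_le _ _)
        (Polynomial.natDegree_C_mul_le _ _)).trans (max_le hT₁deg hT₂deg)
    refine lt_of_le_of_ne hle fun heq => ?_
    have h0 : D.coeff (2 * n) = 0 := by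
      rw [hD, Polynomial.coeff_sub, Polynomial.coeff_C_mul, Polynomial.coeff_C_mul, hT₁, hT₂]
      ring
    rw [← heq, Polynomial.coeff_natDegree, Polynomial.leadingCoeff_eq_zero] at h0
    rw [h0, Polynomial.natDegree_zero] at heq
    omega
  have hD0 : D = 0 := by
    apply Polynomial.eq_zero_of_natDegree_lt_card_of_eval_eq_zero' D S _ (by omega)
    intro s hs
    obtain ⟨hs1, hs2⟩ := hS s hs
    rw [hD, Polynomial.eval_sub, Polynomial.eval_mul, Polynomial.eval_mul, hT₁eval s hs1,
      hT₂eval s hs1, hs2, hzero s hs1 hs2]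
    simp
  have hprop : ∀ ζ : ℂ, ‖ζ‖ = 1 →
      taylorCoeff G n * (F (r * ζ)).re = taylorCoeff F n * (G (r * ζ)).re := by
    intro ζ hζ
    have h1 : D.eval ζ = 0 := by rw [hD0, Polynomial.eval_zero]
    rw [hD, Polynomial.eval_sub, Polynomial.eval_mul, Polynomial.eval_mul, Polynomial.eval_C,
      Polynomial.eval_C, hT₁eval ζ hζ, hT₂eval ζ hζ] at h1
    have hζ0 : ζ ≠ 0 := norm_ne_zero_iff.1 (by rw [hζ]; exact one_ne_zero)
    have h2 : (ζ ^ n * 2) * (taylorCoeff G n * (F (r * ζ)).re -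
        taylorCoeff F n * (G (r * ζ)).re) = 0 := by
      rw [← h1]; ring
    exact sub_eq_zero.1 ((mul_eq_zero.1 h2).resolve_left
      (mul_ne_zero (pow_ne_zero n hζ0) two_ne_zero))
  obtain ⟨ζ₀, hζ₀, hFζ₀⟩ : ∃ ζ : ℂ, ‖ζ‖ = 1 ∧ (F (r * ζ)).re ≠ 0 := by
    by_contra! hcon
    have := circleCoeff_eq_zero_of_eq_zero (V := fun ζ => (F (r * ζ)).re) hcon n
    rw [circleCoeff_re_of_pos hF r hn] at this
    exact mul_ne_zero hpi (mul_ne_zero (pow_ne_zero n hr0) hFn) this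
  have hGζ₀ : (G (r * ζ₀)).re ≠ 0 := fun h0 => hFζ₀ (hzero ζ₀ hζ₀ h0)
  set b : ℝ := (F (r * ζ₀)).re / (G (r * ζ₀)).re with hb
  have hFb : (F (r * ζ₀)).re = b * (G (r * ζ₀)).re := by
    rw [hb, div_mul_cancel₀ _ hGζ₀]
  have hlead : taylorCoeff F n = taylorCoeff G n * b := by
    have h1 := hprop ζ₀ hζ₀
    rw [hFb] at h1
    have hGζ₀' : (((G (r * ζ₀)).re : ℝ) : ℂ) ≠ 0 := by exact_mod_cast hGζ₀
    apply mul_right_cancel₀ hGζ₀'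
    rw [← h1]
    push_cast
    ring
  have hGn : taylorCoeff G n ≠ 0 := by
    intro h0
    rw [h0, zero_mul] at hlead
    exact hFn hlead
  refine ⟨b, ?_, fun z => ?_⟩
  · have := hFGr ζ₀ hζ₀
    rw [hFb, abs_mul] at this
    exact le_of_mul_le_mul_right this (abs_pos.2 hGζ₀)
  · have := re_eq_zero_of_re_eq_zero_on_circle (H := fun z => F z - b * G z) (by fun_prop) hr (by
      intro ζ hζ
      have h1 := hprop ζ hζ
      rw [hlead, mul_assoc] at h1
      have h2 := mul_left_cancel₀ hGn h1
      have h3 : (F (r * ζ)).re = b * (G (r * ζ)).re := by exact_mod_cast h2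
      rw [Complex.sub_re, Complex.re_ofReal_mul, h3, sub_self]) z
    rw [Complex.sub_re, Complex.re_ofReal_mul] at this
    linarith

/-! ### The theorem. -/

theorem IsPlanePolynomial.const_mul {u : ℂ → ℝ} (hu : IsPlanePolynomial u) (c : ℝ) :
    IsPlanePolynomial fun z => c * u z := by
  obtain ⟨P, hP⟩ := hu
  exact ⟨MvPolynomial.C c * P, fun z => by rw [map_mul, MvPolynomial.eval_C, ← hP]⟩

theorem isPlaneLine_range_smul {t : ℂ → ℝ} (ht : Function.Surjective t) {w : ℂ} (hw : w ≠ 0) :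
    IsPlaneLine (Set.range fun z => t z • w) := by
  refine ⟨(Submodule.span ℝ {w}).toAffineSubspace, ⟨0, by simp⟩, ?_, ?_⟩
  · rw [Submodule.toAffineSubspace_direction, finrank_span_singleton hw]
  · ext x
    simp only [Set.mem_range, SetLike.mem_coe, Submodule.mem_toAffineSubspace,
      Submodule.mem_span_singleton]
    constructor
    · rintro ⟨z, hz⟩
      exact ⟨t z, hz⟩
    · rintro ⟨c, hc⟩
      obtain ⟨z, hz⟩ := ht c
      exact ⟨z, by rw [hz, hc]⟩

theorem theorem3 (u v : ℂ → ℝ) (hf : IsEntireHarmonicMap u v)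
    (hu : IsPlanePolynomial u) (hu_nonconst : ¬ ∃ c : ℝ, ∀ z : ℂ, u z = c)
    (a R : ℝ) (ha : 0 < a) (hR : 0 < R)
    (hcone : planeMap u v '' (Metric.ball (0 : ℂ) R)ᶜ ⊆ doubleCone a) :
    (∃ b : ℝ, |b| ≤ a ∧ ∀ z : ℂ, u z = b * v z) ∧
      IsPlanePolynomial v ∧ IsPlaneLine (Set.range (planeMap u v)) := by
  obtain ⟨F, hFan, hFu⟩ := hf.1.exists_analyticOnNhd_univ_re_eq
  obtain ⟨G, hGan, hGv⟩ := hf.2.exists_analyticOnNhd_univ_re_eq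
  have hF : Differentiable ℂ F := fun z => (hFan z (Set.mem_univ z)).differentiableAt
  have hG : Differentiable ℂ G := fun z => (hGan z (Set.mem_univ z)).differentiableAt
  have hFu' : ∀ z, (F z).re = u z := fun z => congrFun hFu z
  have hGv' : ∀ z, (G z).re = v z := fun z => congrFun hGv z
  have hdom : ∀ z : ℂ, R ≤ ‖z‖ → |(F z).re| ≤ a * |(G z).re| := by
    intro z hz
    have := hcone (Set.mem_image_of_mem (planeMap u v)
      (show z ∈ (Metric.ball (0 : ℂ) R)ᶜ by simpa using hz))
    simpa [doubleCone, planeMap, hFu', hGv'] using this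
  rw [← hFu] at hu
  obtain ⟨N, hN⟩ := exists_taylorCoeff_eq_zero_of_isPlanePolynomial hF hu
  have hnotconst : ∀ p : Polynomial ℂ, (∀ z, F z = p.eval z) → p.natDegree ≠ 0 := by
    intro p hp h0
    apply hu_nonconst
    rw [Polynomial.eq_C_of_natDegree_eq_zero h0] at hp
    exact ⟨(p.coeff 0).re, fun z => by rw [← hFu', hp, Polynomial.eval_C]⟩
  classical
  -- `Nat.findGreatest` defaults to `0` when no index qualifies; nonconstancy of `u` excludes `n =
  -- 0`, so `n` is the degree of `F`.
  set n := Nat.findGreatest (fun m => taylorCoeff F m ≠ 0) N with hn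
  have hFz : ∀ m, n < m → taylorCoeff F m = 0 := by
    intro m hm
    rcases le_or_gt m N with h | h
    · exact not_not.1 (Nat.findGreatest_is_greatest hm h)
    · exact hN m h
  obtain ⟨p, hpn, hp⟩ := exists_polynomial_of_taylorCoeff_eq_zero hF hFz
  have hp0 := hnotconst p hp
  have hn0 : n ≠ 0 := by omega
  have hFn : taylorCoeff F n ≠ 0 := Nat.findGreatest_of_ne_zero hn.symm hn0
  obtain ⟨b, hba, hb⟩ := exists_re_eq_mul_re_of_dominated hF hG hn0 hFz hFn ha.le hdom
  have huv : ∀ z, u z = b * v z := fun z => by rw [← hFu', ← hGv', hb]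
  have hb0 : b ≠ 0 := by
    rintro rfl
    exact hu_nonconst ⟨0, fun z => by rw [huv, zero_mul]⟩
  have hvu : ∀ z, v z = b⁻¹ * u z := fun z => by rw [huv, inv_mul_cancel_left₀ hb0]
  refine ⟨⟨b, hba, huv⟩, ?_, ?_⟩
  · rw [hFu] at hu
    rw [funext hvu]
    exact hu.const_mul b⁻¹
  -- A root of `F - b * c` gives a point where `u = b * c`, hence `v = c`.
  · have hsurj : Function.Surjective v := by
      intro c
      obtain ⟨z, hz⟩ := IsAlgClosed.exists_root (p - Polynomial.C ((b * c : ℝ) : ℂ)) (by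
        intro h
        apply hp0
        rw [← Polynomial.natDegree_sub_C (a := ((b * c : ℝ) : ℂ))]
        exact Polynomial.natDegree_eq_of_degree_eq_some h)
      refine ⟨z, ?_⟩
      rw [Polynomial.IsRoot, Polynomial.eval_sub, Polynomial.eval_C, sub_eq_zero, ← hp] at hz
      rw [hvu, ← hFu', hz, Complex.ofReal_re, inv_mul_cancel_left₀ hb0]
    have hw : (b : ℂ) + Complex.I ≠ 0 := by
      intro h
      simpa using congrArg Complex.im h
    have hpm : planeMap u v = fun z => v z • ((b : ℂ) + Complex.I) := by
      funext z
      rw [planeMap, huv, Complex.real_smul]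
      push_cast
      ring
    rw [hpm]
    exact isPlaneLine_range_smul hsurj hw
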